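/- Let $n\ge 1$, $\mathcal N=\{1,\dots,n\}$, and let $\mu>0$, $0<d_0<d_1$ and $0<\delta_{\min}<\delta_{\max}$ be real numbers. For every robot $i\in\mathcal N$ let $(t^i_k)_{k\in\mathbb N}$ be its sequence of wake-up times, with $0\le t_0^i\le\delta_{\max}$ and $t^i_{k+1}-t^i_k\in[\delta_{\min},\delta_{\max}]$ for all $k\in\mathbb N$. The robots move in the plane with positions $x_i(t)\in\mathbb R^2$, $t\ge 0$, and $\|\cdot\|$ is the Euclidean norm. Let $\mathrm{sat}(v)=\mu v/\|v\|$ if $\|v\|\ge\mu$ and $\mathrm{sat}(v)=v$ otherwise. For $i,j\in\mathcal N$ and $t\ge 0$ let $b_{ij}(t)=1$ if at least one of the following two conditions holds, and $b_{ij}(t)=0$ otherwise: - ($i$ engages) there is $k\in\mathbb N$ with $t\in[t^i_k,t^i_k+\delta_{\min}]$ and $\|x_i(t^i_k)-x_j(t^i_k)\|\ge d_1$; - ($i$ reciprocates) there is $h\in\mathbb N$ with $t\in[t^i_h,t^i_h+\delta_{\min}]$ and $\|x_i(t)-x_j(t)\|\ge d_0$, and there is $k\in\mathbb N$ with $t^j_k\in[t^i_h-\delta_{\max},t^i_h]$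 and $\|x_i(t^j_k)-x_j(t^j_k)\|\ge d_1$. Let $x=(x_1,\dots,x_n)$ be a (Carathéodory) solution on $[0,\infty)$ of $$\dot x_i(t)=\mathrm{sat}\Big(\sum_{j\in\mathcal N}b_{ij}(t)\,(x_j(t)-x_i(t))\Big),\qquad i\in\mathcal N,$$ that is, the right-hand sides are locally integrable and each $x_i$ is $x_i(0)$ plus the integral of the right-hand side from $0$ to $t$. Assume that $4\,\delta_{\max}\,\mu\le d_1-d_0$. Then $x_i^*=\lim_{t\to\infty}x_i(t)$ exists for every $i\in\mathcal N$, and, with $\Delta(t)=\max_{i,j\in\mathcal N}\|x_i(t)-x_j(t)\|$, the limit $\lim_{t\to\infty}\Delta(t)$ exists and is at most $d_1$. -/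

import Mathlib

open MeasureTheory Filter Topology

noncomputable section

namespace MobileRobots

/-- The plane `ℝ²` with its Euclidean norm. -/
abbrev Plane : Type := EuclideanSpace ℝ (Fin 2)

/-- Saturation at level `μ`: vectors of norm at least `μ` are rescaled to norm `μ`. -/
def sat (μ : ℝ) (v : Plane) : Plane :=
  if μ ≤ ‖v‖ then (μ / ‖v‖) • v else v

/-- Admissible wake-up times: robot `i` wakes up at the nonnegative times `τ i 0, τ i 1, …`;
the first one is at most `δmax`, consecutive ones are between `δmin` and `δmax` apart. -/
structure IsWakeUpSchedule {n : ℕ} (δmin δmax : ℝ) (τ : Fin n → ℕ → ℝ) : Prop where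
  zero_le : ∀ i, 0 ≤ τ i 0
  first_le : ∀ i, τ i 0 ≤ δmax
  gap_mem : ∀ i k, τ i (k + 1) - τ i k ∈ Set.Icc δmin δmax

/-- Robot `i` engages with robot `j` at time `t`: it is in a monitoring period at the beginning of
which the two robots were at distance at least `d₁`. -/
def Engages {n : ℕ} (d₁ δmin : ℝ) (τ : Fin n → ℕ → ℝ) (x : Fin n → ℝ → Plane)
    (i j : Fin n) (t : ℝ) : Prop :=
  ∃ k : ℕ, t ∈ Set.Icc (τ i k) (τ i k + δmin) ∧ d₁ ≤ ‖x i (τ i k) - x j (τ i k)‖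

/-- Robot `i` reciprocates towards robot `j` at time `t`: it is in a monitoring period, the two
robots are at distance at least `d₀`, and at some wake-up time of `j` during the last `δmax` time
units before the beginning of this period the two robots were at distance at least `d₁`
(so that `j` engaged with `i`). -/
def Reciprocates {n : ℕ} (d₀ d₁ δmin δmax : ℝ) (τ : Fin n → ℕ → ℝ) (x : Fin n → ℝ → Plane)
    (i j : Fin n) (t : ℝ) : Prop :=
  ∃ h : ℕ, t ∈ Set.Icc (τ i h) (τ i h + δmin) ∧ d₀ ≤ ‖x i t - x j t‖ ∧
    ∃ k : ℕ, τ j k ∈ Set.Icc (τ i h - δmax) (τ i h) ∧ d₁ ≤ ‖x i (τ j k) - x j (τ j k)‖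

open Classical in
/-- The weight `b i j t`: it is `1` if `i` engages with `j` or reciprocates towards `j` at time `t`,
and `0` otherwise. -/
def weight {n : ℕ} (d₀ d₁ δmin δmax : ℝ) (τ : Fin n → ℕ → ℝ) (x : Fin n → ℝ → Plane)
    (i j : Fin n) (t : ℝ) : ℝ :=
  if Engages d₁ δmin τ x i j t ∨ Reciprocates d₀ d₁ δmin δmax τ x i j t then 1 else 0

/-- The velocity prescribed to robot `i` at time `t`. -/
def velocity {n : ℕ} (μ d₀ d₁ δmin δmax : ℝ) (τ : Fin n → ℕ → ℝ) (x : Fin n → ℝ → Plane)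
    (i : Fin n) (t : ℝ) : Plane :=
  sat μ (∑ j, weight d₀ d₁ δmin δmax τ x i j t • (x j t - x i t))

/-- `x` is a (Carathéodory) trajectory on `[0, ∞)` of the saturated consensus system: the prescribed
velocities are locally integrable and every `x i` is the integral of its velocity. -/
def IsTrajectory {n : ℕ} (μ d₀ d₁ δmin δmax : ℝ) (τ : Fin n → ℕ → ℝ)
    (x : Fin n → ℝ → Plane) : Prop :=
  ∀ i, ∀ t : ℝ, 0 ≤ t →
    IntervalIntegrable (velocity μ d₀ d₁ δmin δmax τ x i) volume 0 t ∧
    x i t = x i 0 + ∫ s in (0 : ℝ)..t, velocity μ d₀ d₁ δmin δmax τ x i s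

/-- The group diameter `max_{i,j} ‖x i t - x j t‖`. -/
def groupDiam {n : ℕ} [NeZero n] (x : Fin n → ℝ → Plane) (t : ℝ) : ℝ :=
  (Finset.univ : Finset (Fin n × Fin n)).sup' Finset.univ_nonempty
    (fun p => ‖x p.1 t - x p.2 t‖)

end MobileRobots

end

/-! Saturation only multiplies a velocity by a positive scalar, so each coordinate follows a linear
consensus flow with weights in `[0, 1]`. Trajectories are bounded, so active weights stay above some
`α > 0`. The speed bound makes attraction reciprocal with a delay: an engagement makes each robot
attract the other for a duration `δmin` within the next `2 * δmax`, and every active weight traces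
back to an engagement at most `2 * δmax` earlier (`exists_weight_eq_one`,
`exists_engagement_of_weight_ne_zero`).

If a pair engaged infinitely often, let `C` be its component in the graph of such pairs. Eventually
`C` is free of outside influence, and each proper part of it keeps engaging with the rest. Consensus
then holds in `C` (`eventually_sub_le`), so the pair ends up closer than `d₁`, a contradiction.
Hence engagements stop, then all motion stops, and later wake-ups see only distances below `d₁`.

Consensus rests on a margin argument: agents below the maximum by a margin lose only a fixed factor
of it until the next event with the others, however long the wait, and that event drags one more
agent below the maximum (`exists_growth`). -/

/-- Comparison with a linear equation: a continuous `p` whose rate of change is at least `r - K p`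
dominates the solution of `q' = r - K q` with the same initial value. -/
theorem exp_lower_bound {p v : ℝ → ℝ} {K r a b : ℝ} (hK : K ≠ 0)
    (hcont : ContinuousOn p (Set.Icc a b))
    (hv : ∀ s t, a ≤ s → s ≤ t → t ≤ b → IntervalIntegrable v volume s t)
    (hp : ∀ s t, a ≤ s → s ≤ t → t ≤ b → p t - p s = ∫ u in s..t, v u)
    (h : ∀ t ∈ Set.Icc a b, r - K * p t ≤ v t) :
    ∀ t ∈ Set.Icc a b,
      p a * Real.exp (-K * (t - a)) + r / K * (1 - Real.exp (-K * (t - a))) ≤ p t := by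
  intro t ht
  have key := le_gronwallBound_of_liminf_deriv_right_le (f := fun t => -p t)
    (f' := fun t => K * p t - r) (δ := -p a) (K := -K) (ε := -r) (a := a) (b := b)
    hcont.neg ?_ le_rfl (fun x _ => by linarith) t ht
  · rw [gronwallBound_of_K_ne_0 (neg_ne_zero.2 hK)] at key
    simp only [neg_div_neg_eq] at key
    nlinarith [key]
  intro x hx c hc
  have hg : ContinuousWithinAt (fun t => K * p t - r) (Set.Icc a b) x :=
    ((hcont.const_smul K).sub continuousOn_const) x ⟨hx.1, hx.2.le⟩
  have hev : ∀ᶠ z in 𝓝[>] x, z ∈ Set.Ioo x b := Ioo_mem_nhdsGT hx.2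
  obtain ⟨c', hc', hc'c⟩ := exists_between hc
  have h1 : ∀ᶠ z in 𝓝[Set.Icc a b] x, K * p z - r < c' := hg.eventually (gt_mem_nhds hc')
  rw [eventually_nhdsWithin_iff, Metric.eventually_nhds_iff] at h1
  obtain ⟨e, he, h1⟩ := h1
  have hev2 : ∀ᶠ z in 𝓝[>] x, z ∈ Set.Ioo x (x + e) := Ioo_mem_nhdsGT (by linarith)
  -- `p` need not be differentiable where `v` is only integrable; Gronwall needs just a bound on
  -- right difference quotients, which follows by integrating `h`.
  refine Eventually.frequently ?_
  filter_upwards [hev, hev2] with z hz hz2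
  have hint := hv x z hx.1 hz.1.le hz.2.le
  have h2 : -(c' * (z - x)) ≤ ∫ u in x..z, v u := by
    have := intervalIntegral.integral_mono_on (μ := volume) (f := fun _ => -c') (g := v) hz.1.le
      intervalIntegrable_const hint ?_
    · simp only [intervalIntegral.integral_const, smul_eq_mul] at this
      linarith
    · intro u hu
      have hu' : u ∈ Set.Icc a b := ⟨hx.1.trans hu.1, hu.2.trans hz.2.le⟩
      have h3 := h1 (y := u) (by
        rw [Real.dist_eq, abs_lt]; constructor <;> linarith [hu.1, hu.2, hz2.2]) hu'
      linarith [h u hu']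
  rw [← hp x z hx.1 hz.1.le hz.2.le] at h2
  have hzx : 0 < z - x := sub_pos.2 hz.1
  rw [inv_mul_lt_iff₀ hzx]
  nlinarith

/-! ### Linear consensus flows: exponential estimates and maximum principle -/

namespace MobileRobots

variable {ι : Type*} [Fintype ι]

/-- Real-valued consensus dynamics `y i' = ∑ j, a i j (y j - y i)` on `[0, ∞)`, in integral form,
with weights in `[0, 1]`. -/
structure IsConsensusFlow (a : ι → ι → ℝ → ℝ) (y : ι → ℝ → ℝ) : Prop where
  nonneg : ∀ i j t, 0 ≤ a i j t
  le_one : ∀ i j t, a i j t ≤ 1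
  continuousOn : ∀ i, ContinuousOn (y i) (Set.Ici 0)
  integrable : ∀ i s t, 0 ≤ s → s ≤ t →
    IntervalIntegrable (fun u => ∑ j, a i j u * (y j u - y i u)) volume s t
  sub_eq : ∀ i s t, 0 ≤ s → s ≤ t →
    y i t - y i s = ∫ u in s..t, ∑ j, a i j u * (y j u - y i u)

namespace IsConsensusFlow

variable {a : ι → ι → ℝ → ℝ} {y : ι → ℝ → ℝ}

theorem neg (hy : IsConsensusFlow a y) : IsConsensusFlow a (fun i t => -y i t) := by
  have e : ∀ i, (fun u => ∑ j, a i j u * (-y j u - -y i u)) =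
      fun u => -∑ j, a i j u * (y j u - y i u) := by
    intro i; funext u; rw [← Finset.sum_neg_distrib]
    exact Finset.sum_congr rfl fun j _ => by ring
  refine ⟨hy.nonneg, hy.le_one, fun i => (hy.continuousOn i).neg, fun i s t hs hst => ?_,
    fun i s t hs hst => ?_⟩
  · rw [e]; exact (hy.integrable i s t hs hst).neg
  · rw [e, intervalIntegral.integral_neg, ← hy.sub_eq i s t hs hst]; ring

/-- Lower bound on `M - y i` in terms of a lower bound `r` on the pull away from `M`. -/
theorem gap_lower_bound (hy : IsConsensusFlow a y) {s b M r : ℝ} (hs : 0 ≤ s) {i : ι}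
    (h : ∀ t ∈ Set.Icc s b,
      r - Fintype.card ι * (M - y i t) ≤ -∑ j, a i j t * (y j t - y i t)) :
    ∀ t ∈ Set.Icc s b,
      (M - y i s) * Real.exp (-Fintype.card ι * (t - s)) +
        r / Fintype.card ι * (1 - Real.exp (-Fintype.card ι * (t - s))) ≤ M - y i t := by
  have : Nonempty ι := ⟨i⟩
  refine exp_lower_bound (p := fun t => M - y i t)
    (v := fun t => -∑ j, a i j t * (y j t - y i t)) (Nat.cast_ne_zero.2 Fintype.card_ne_zero)
    (continuousOn_const.sub ((hy.continuousOn i).mono fun t ht => hs.trans ht.1)) ?_ ?_ h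
  · intro u t hu hut _
    exact (hy.integrable i u t (hs.trans hu) hut).neg
  · intro u t hu hut _
    rw [intervalIntegral.integral_neg, ← hy.sub_eq i u t (hs.trans hu) hut]; ring

/-- The distance to an upper bound `M` of all influential agents decays at most exponentially. -/
theorem gap_decay (hy : IsConsensusFlow a y) {s b M : ℝ} (hs : 0 ≤ s) {i : ι}
    (hi : ∀ t ∈ Set.Icc s b, y i t ≤ M)
    (h : ∀ t ∈ Set.Icc s b, ∀ j, a i j t ≠ 0 → y j t ≤ M) :
    ∀ t ∈ Set.Icc s b, (M - y i s) * Real.exp (-Fintype.card ι * (t - s)) ≤ M - y i t := by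
  intro t ht
  have := hy.gap_lower_bound (M := M) (r := 0) (b := b) hs (i := i) ?_ t ht
  · simpa using this
  intro t ht
  have h1 : ∑ j, a i j t * (y j t - y i t) ≤ ∑ _j : ι, (M - y i t) := by
    refine Finset.sum_le_sum fun j _ => ?_
    by_cases h0 : a i j t = 0
    · rw [h0, zero_mul]; linarith [hi t ht]
    · nlinarith [h t ht j h0, hi t ht, hy.nonneg i j t, hy.le_one i j t]
  simp only [Finset.sum_const, Finset.card_univ, nsmul_eq_mul] at h1
  linarith

/-- An agent that is pulled with weight at least `α` by an agent staying a distance `c` below `M`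
ends up below `M`. -/
theorem gap_of_pull (hy : IsConsensusFlow a y) {s δ M α c : ℝ} (hs : 0 ≤ s) (hδ : 0 ≤ δ)
    {i j : ι} (hc : 0 ≤ c) (hα : ∀ t ∈ Set.Icc s (s + δ), α ≤ a j i t)
    (hi : ∀ t ∈ Set.Icc s (s + δ), c ≤ M - y i t)
    (hj : ∀ t ∈ Set.Icc s (s + δ), y j t ≤ M)
    (h : ∀ t ∈ Set.Icc s (s + δ), ∀ k, a j k t ≠ 0 → y k t ≤ M) :
    α * c / Fintype.card ι * (1 - Real.exp (-Fintype.card ι * δ)) ≤ M - y j (s + δ) := by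
  have := hy.gap_lower_bound (M := M) (r := α * c) (b := s + δ) hs (i := j) ?_ (s + δ)
    ⟨by linarith, le_rfl⟩
  · rw [add_sub_cancel_left] at this
    have h0 : 0 ≤ (M - y j s) * Real.exp (-Fintype.card ι * δ) :=
      mul_nonneg (sub_nonneg.2 (hj s ⟨le_rfl, by linarith⟩)) (Real.exp_nonneg _)
    linarith
  intro t ht
  -- Summing over `k` gives the decay rate `Fintype.card ι`; of the nonnegative terms `a j k t * (M
  -- - y k t)` only `k = i` is kept.
  have h1 : ∀ k, a j k t * (y k t - y j t) ≤ (M - y j t) - a j k t * (M - y k t) := fun k => by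
    nlinarith [hj t ht, hy.le_one j k t]
  have h2 : a j i t * (M - y i t) ≤ ∑ k, a j k t * (M - y k t) := by
    refine Finset.single_le_sum (f := fun k => a j k t * (M - y k t)) (fun k _ => ?_)
      (Finset.mem_univ i)
    by_cases h0 : a j k t = 0
    · simp [h0]
    · exact mul_nonneg (hy.nonneg j k t) (sub_nonneg.2 (h t ht k h0))
  have h3 := Finset.sum_le_sum fun k (_ : k ∈ Finset.univ) => h1 k
  rw [Finset.sum_sub_distrib, Finset.sum_const, Finset.card_univ, nsmul_eq_mul] at h3
  have h4 : α * c ≤ a j i t * (M - y i t) :=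
    mul_le_mul (hα t ht) (hi t ht) hc (hy.nonneg j i t)
  linarith

/-- Maximum principle, strict version: see `le_of_closed`. -/
theorem lt_of_closed (hy : IsConsensusFlow a y) {s b M : ℝ} (hs : 0 ≤ s) {S : Finset ι}
    (h : ∀ t ∈ Set.Icc s b, ∀ i ∈ S, ∀ j ∉ S, a i j t = 0) (hM : ∀ i ∈ S, y i s < M) :
    ∀ t ∈ Set.Icc s b, ∀ i ∈ S, y i t < M := by
  by_contra! hcon
  obtain ⟨t, ht, i, hi, hit⟩ := hcon
  let B : Set ℝ := ⋃ i ∈ S, {t ∈ Set.Icc s b | M ≤ y i t}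
  have hBc : IsCompact B := by
    refine S.isCompact_biUnion fun i _ => ?_
    have : ContinuousOn (y i) (Set.Icc s b) := (hy.continuousOn i).mono fun t ht => hs.trans ht.1
    exact isCompact_Icc.of_isClosed_subset
      (this.preimage_isClosed_of_isClosed isClosed_Icc isClosed_Ici) fun t ht => ht.1
  have hBn : B.Nonempty := ⟨t, by simp only [B, Set.mem_iUnion]; exact ⟨i, hi, ht, hit⟩⟩
  -- At the first time `u` when some agent of `S` reaches `M`, exponential decay of its gap on `[s,
  -- u]` still leaves the gap positive.
  obtain ⟨u, huB, hu⟩ := hBc.exists_isLeast hBn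
  simp only [B, Set.mem_iUnion] at huB
  obtain ⟨k, hk, hu1, hu2⟩ := huB
  have hlt : ∀ v ∈ Set.Ico s u, ∀ j ∈ S, y j v < M := by
    intro v hv j hj
    by_contra! hle
    have : v ∈ B := by
      simp only [B, Set.mem_iUnion]
      exact ⟨j, hj, ⟨hv.1, hv.2.le.trans hu1.2⟩, hle⟩
    exact absurd (hu this) (not_le.2 hv.2)
  have hsu : s < u := by
    rcases hu1.1.eq_or_lt with h0 | h0
    · rw [← h0] at hu2; exact absurd (hM k hk) (not_lt.2 hu2)
    · exact h0
  have hle : ∀ v ∈ Set.Icc s u, ∀ j ∈ S, y j v ≤ M := by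
    intro v hv j hj
    have hcl : v ∈ closure (Set.Ico s u) := by rwa [closure_Ico hsu.ne]
    have hcv : ContinuousWithinAt (y j) (Set.Ico s u) v :=
      ((hy.continuousOn j) v (hs.trans hv.1)).mono fun w hw => hs.trans hw.1
    have := hcv.mem_closure hcl (t := Set.Iic M) fun w hw => (hlt w hw j hj).le
    rwa [isClosed_Iic.closure_eq] at this
  have := hy.gap_decay (M := M) (b := u) hs (i := k) (fun t ht => hle t ht k hk)
    (fun t ht j h0 => hle t ht j (by
      by_contra hj; exact h0 (h t ⟨ht.1, ht.2.trans hu1.2⟩ k hk j hj))) u ⟨hsu.le, le_rfl⟩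
  have hpos : 0 < (M - y k s) * Real.exp (-Fintype.card ι * (u - s)) :=
    mul_pos (sub_pos.2 (hM k hk)) (Real.exp_pos _)
  linarith

/-- Maximum principle: an upper bound for a set of agents that is not influenced from outside
persists. -/
theorem le_of_closed (hy : IsConsensusFlow a y) {s b M : ℝ} (hs : 0 ≤ s) {S : Finset ι}
    (h : ∀ t ∈ Set.Icc s b, ∀ i ∈ S, ∀ j ∉ S, a i j t = 0) (hM : ∀ i ∈ S, y i s ≤ M) :
    ∀ t ∈ Set.Icc s b, ∀ i ∈ S, y i t ≤ M := by
  intro t ht i hi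
  refine le_of_forall_pos_lt_add fun ε hε => ?_
  exact hy.lt_of_closed hs h (M := M + ε) (fun i hi => by linarith [hM i hi]) t ht i hi

theorem ge_of_closed (hy : IsConsensusFlow a y) {s b M : ℝ} (hs : 0 ≤ s) {S : Finset ι}
    (h : ∀ t ∈ Set.Icc s b, ∀ i ∈ S, ∀ j ∉ S, a i j t = 0) (hM : ∀ i ∈ S, M ≤ y i s) :
    ∀ t ∈ Set.Icc s b, ∀ i ∈ S, M ≤ y i t := by
  intro t ht i hi
  have := hy.neg.le_of_closed hs h (M := -M) (fun i hi => neg_le_neg (hM i hi)) t ht i hi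
  linarith

end IsConsensusFlow

end MobileRobots

/-! ### Consensus under delayed reciprocity -/

namespace MobileRobots

variable {ι : Type*} [Fintype ι]

/-- Non-instantaneous reciprocity, driven by symmetric events `E i j s`: after time `T₀`, a weight
`a i j` is active only at most `W` time units after an event, every event makes the weight at
least `α` for a duration `δ` in the following `W` time units, the agents in `C` are not influenced
from outside, and every proper part of `C` keeps having events with the rest of `C`. -/
structure HasReciprocalEvents (a : ι → ι → ℝ → ℝ) (E : ι → ι → ℝ → Prop) (C : Finset ι)
    (α δ W T₀ : ℝ) : Prop where
  pos : 0 < α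
  duration_pos : 0 < δ
  lag_nonneg : 0 ≤ W
  start_nonneg : 0 ≤ T₀
  symm : ∀ i j s, E i j s → E j i s
  event_of_active : ∀ i j t, T₀ ≤ t → a i j t ≠ 0 → ∃ s ∈ Set.Icc (t - W) t, E i j s
  active_of_event : ∀ i j s, T₀ ≤ s → E i j s →
    ∃ h, s ≤ h ∧ h + δ ≤ s + W ∧ ∀ t ∈ Set.Icc h (h + δ), α ≤ a i j t
  closed : ∀ i ∈ C, ∀ j ∉ C, ∀ t, T₀ ≤ t → a i j t = 0
  connected : ∀ S ⊂ C, S.Nonempty → ∀ T, ∃ s, T ≤ s ∧ ∃ i ∈ S, ∃ j ∈ C, j ∉ S ∧ E i j s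

namespace HasReciprocalEvents

variable {a : ι → ι → ℝ → ℝ} {y : ι → ℝ → ℝ} {E : ι → ι → ℝ → Prop} {C : Finset ι}
  {α δ W T₀ : ℝ}

theorem upper_bound_persists (hE : HasReciprocalEvents a E C α δ W T₀) (hy : IsConsensusFlow a y) {s M : ℝ}
    (hs : T₀ ≤ s) (hM : ∀ i ∈ C, y i s ≤ M) {t : ℝ} (ht : s ≤ t) : ∀ i ∈ C, y i t ≤ M :=
  hy.le_of_closed (b := t) (hE.start_nonneg.trans hs)
    (fun u hu i hi j hj => hE.closed i hi j hj u (hs.trans hu.1)) hM t ⟨ht, le_rfl⟩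

theorem lower_bound_persists (hE : HasReciprocalEvents a E C α δ W T₀) (hy : IsConsensusFlow a y) {s M : ℝ}
    (hs : T₀ ≤ s) (hM : ∀ i ∈ C, M ≤ y i s) {t : ℝ} (ht : s ≤ t) : ∀ i ∈ C, M ≤ y i t :=
  hy.ge_of_closed (b := t) (hE.start_nonneg.trans hs)
    (fun u hu i hi j hj => hE.closed i hi j hj u (hs.trans hu.1)) hM t ⟨ht, le_rfl⟩

theorem gap_mul_exp_le (hE : HasReciprocalEvents a E C α δ W T₀) (hy : IsConsensusFlow a y)
    {s t L M c : ℝ} (hs : T₀ ≤ s) (hM : ∀ i ∈ C, y i s ≤ M) (hc : 0 ≤ c) {i : ι} (hi : i ∈ C)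
    (hci : c ≤ M - y i s) (hst : s ≤ t) (htL : t ≤ s + L) :
    c * Real.exp (-Fintype.card ι * L) ≤ M - y i t := by
  refine le_trans (mul_le_mul hci (Real.exp_le_exp.2 ?_) (Real.exp_nonneg _) (hc.trans hci))
    (hy.gap_decay (M := M) (b := t) (hE.start_nonneg.trans hs)
      (fun u hu => hE.upper_bound_persists hy hs hM hu.1 i hi) (fun u hu j h0 =>
      hE.upper_bound_persists hy hs hM hu.1 j (by
        by_contra hj; exact h0 (hE.closed i hi j hj u (hs.trans hu.1)))) t ⟨hst, le_rfl⟩)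
  have : (0 : ℝ) ≤ Fintype.card ι := Nat.cast_nonneg _
  nlinarith

/-- As long as there is no event between `S` and the rest of `C`, the agents in `S` keep a
distance from the upper bound `M`. -/
theorem gap_of_no_event (hE : HasReciprocalEvents a E C α δ W T₀) (hy : IsConsensusFlow a y)
    {s b M c : ℝ} {S : Finset ι} (hs : T₀ ≤ s) (hS : S ⊆ C) (hM : ∀ i ∈ C, y i s ≤ M)
    (hc : 0 ≤ c) (hcS : ∀ i ∈ S, c ≤ M - y i s)
    (hno : ∀ t ∈ Set.Icc s b, ∀ i ∈ S, ∀ j ∈ C, j ∉ S → ¬ E i j t) :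
    ∀ t ∈ Set.Icc s b, ∀ i ∈ S, c * Real.exp (-Fintype.card ι * W) ≤ M - y i t := by
  intro t ht i hi
  have hW := hE.lag_nonneg
  -- Until `s + W`, events before `s` may still act, which costs the factor `exp (-n W)`, with `n`
  -- the number of agents. Afterwards `S` is closed and the maximum principle loses nothing.
  rcases le_total t (s + W) with h | h
  · exact hE.gap_mul_exp_le hy hs hM hc (hS hi) (hcS i hi) ht.1 h
  · have h1 : ∀ i ∈ S, y i (s + W) ≤ M - c * Real.exp (-Fintype.card ι * W) := by
      intro i hi
      have := hE.gap_mul_exp_le hy hs hM hc (hS hi) (hcS i hi) (t := s + W) (L := W)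
        (by linarith) le_rfl
      linarith
    have h2 := hy.le_of_closed (b := b) (by linarith [hE.start_nonneg]) ?_ h1 t ⟨h, ht.2⟩ i hi
    · linarith
    intro u hu k hk j hj
    by_contra h0
    by_cases hjC : j ∈ C
    · obtain ⟨v, hv, hev⟩ := hE.event_of_active k j u (by linarith [hu.1]) h0
      exact hno v ⟨by linarith [hu.1, hv.1], hv.2.trans hu.2⟩ k hk j hjC hj hev
    · exact h0 (hE.closed k (hS hk) j hjC u (by linarith [hu.1]))

/-- There is a next event between `S` and the rest of `C`, up to a time lag of `1`, and the agents
in `S` keep a distance from the upper bound `M` until then. -/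
theorem exists_next_event (hE : HasReciprocalEvents a E C α δ W T₀) (hy : IsConsensusFlow a y)
    {s M c : ℝ} {S : Finset ι} (hs : T₀ ≤ s) (hS : S ⊂ C) (hSn : S.Nonempty)
    (hM : ∀ i ∈ C, y i s ≤ M) (hc : 0 ≤ c) (hcS : ∀ i ∈ S, c ≤ M - y i s) :
    ∃ b t, s ≤ b ∧ b ≤ t ∧ t ≤ b + 1 ∧ (∃ i ∈ S, ∃ j ∈ C, j ∉ S ∧ E i j t) ∧
      ∀ i ∈ S, c * Real.exp (-Fintype.card ι * W) ≤ M - y i b := by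
  classical
  -- A first event time need not exist, so waiting time is counted in whole units; this is the lag
  -- of `1`.
  have hex : ∃ N : ℕ, ∃ t ∈ Set.Icc s (s + N), ∃ i ∈ S, ∃ j ∈ C, j ∉ S ∧ E i j t := by
    obtain ⟨t, hst, h⟩ := hE.connected S hS hSn s
    obtain ⟨N, hN⟩ := exists_nat_ge (t - s)
    exact ⟨N, t, ⟨hst, by linarith⟩, h⟩
  obtain ⟨t, ht, hev⟩ := Nat.find_spec hex
  rcases Nat.eq_zero_or_pos (Nat.find hex) with h0 | h0
  · rw [h0] at ht
    simp only [Nat.cast_zero, add_zero, Set.Icc_self, Set.mem_singleton_iff] at ht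
    subst ht
    refine ⟨t, t, le_rfl, le_rfl, by linarith, hev, fun i hi => ?_⟩
    exact hE.gap_mul_exp_le hy hs hM hc (hS.1 hi) (hcS i hi) le_rfl
      (by linarith [hE.lag_nonneg])
  · obtain ⟨m, hm⟩ := Nat.exists_eq_succ_of_ne_zero h0.ne'
    have hmin := Nat.find_min hex (m := m) (by omega)
    rw [hm, Nat.succ_eq_add_one, Nat.cast_add, Nat.cast_one] at ht
    have hm0 : (0 : ℝ) ≤ m := Nat.cast_nonneg m
    refine ⟨s + m, t, by linarith, ?_, by linarith [ht.2], hev, fun i hi => ?_⟩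
    · by_contra! hlt
      exact hmin ⟨t, ⟨ht.1, hlt.le⟩, hev⟩
    · refine hE.gap_of_no_event hy hs hS.1 hM hc hcS (b := s + m) ?_ (s + m)
        ⟨by linarith, le_rfl⟩ i hi
      intro u hu k hk j hj hjS hkj
      exact hmin ⟨u, hu, k, hk, j, hj, hjS, hkj⟩

/-- The set of agents that are below the upper bound `M` by a margin can be enlarged, at the price
of a uniform factor in the margin. -/
theorem exists_growth (hE : HasReciprocalEvents a E C α δ W T₀) (hy : IsConsensusFlow a y)
    [Nonempty ι] [DecidableEq ι] :
    ∃ κ : ℝ, 0 < κ ∧ ∀ (s M c : ℝ) (S : Finset ι), T₀ ≤ s → S ⊂ C → S.Nonempty →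
      (∀ i ∈ C, y i s ≤ M) → 0 ≤ c → (∀ i ∈ S, c ≤ M - y i s) →
      ∃ s', s ≤ s' ∧ ∃ j ∈ C, j ∉ S ∧ ∀ i ∈ insert j S, κ * c ≤ M - y i s' := by
  set n : ℝ := (Fintype.card ι : ℝ) with hn
  have hn0 : 0 < n := by rw [hn]; exact_mod_cast Fintype.card_pos
  have hδ := hE.duration_pos
  have hα := hE.pos
  have hW := hE.lag_nonneg
  -- `q` is the loss in `S`: first up to `b`, then over `[b, t + W]`, of length at most `W + 1`.
  -- Below, `γ` is the margin gained by the new agent during the pull, decayed until `t + W`.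
  set q : ℝ := Real.exp (-n * W) * Real.exp (-n * (W + 1)) with hq
  have hq0 : 0 < q := mul_pos (Real.exp_pos _) (Real.exp_pos _)
  set γ : ℝ := α * q / n * (1 - Real.exp (-n * δ)) * Real.exp (-n * W) with hγ
  have hexp : Real.exp (-n * δ) < 1 := Real.exp_lt_one_iff.2 (by nlinarith)
  have hγ0 : 0 < γ := by
    have : 0 < 1 - Real.exp (-n * δ) := by linarith
    positivity
  refine ⟨min q γ, lt_min hq0 hγ0, ?_⟩
  intro s M c S hs hS hSn hM hc hcS
  obtain ⟨b, t, hsb, hbt, htb, ⟨i, hi, j, hj, hjS, hij⟩, hgap⟩ :=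
    hE.exists_next_event hy hs hS hSn hM hc hcS
  have hMb := hE.upper_bound_persists hy hs hM hsb
  have hb : T₀ ≤ b := hs.trans hsb
  have hgap' : ∀ u ∈ Set.Icc b (t + W), ∀ i ∈ S, c * q ≤ M - y i u := by
    intro u hu i hi
    have := hE.gap_mul_exp_le hy hb hMb (mul_nonneg hc (Real.exp_nonneg _)) (hS.1 hi) (hgap i hi)
      (L := W + 1) hu.1 (by linarith [hu.2])
    rwa [mul_assoc] at this
  obtain ⟨h, hth, hhW, hact⟩ := hE.active_of_event j i t (hb.trans hbt) (hE.symm _ _ _ hij)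
  have hMh : ∀ u, b ≤ u → ∀ i ∈ C, y i u ≤ M := fun u hu => hE.upper_bound_persists hy hb hMb hu
  have hpull := hy.gap_of_pull (s := h) (δ := δ) (M := M) (α := α) (c := c * q) (i := i) (j := j)
    (by linarith [hE.start_nonneg]) hδ.le (mul_nonneg hc hq0.le) hact
    (fun u hu => hgap' u ⟨by linarith [hu.1], by linarith [hu.2]⟩ i hi)
    (fun u hu => hMh u (by linarith [hu.1]) j hj)
    (fun u hu k h0 => hMh u (by linarith [hu.1]) k (by
      by_contra hk; exact h0 (hE.closed j hj k hk u (by linarith [hu.1]))))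
  have hj' := hE.gap_mul_exp_le hy (s := h + δ) (t := t + W) (L := W) (by linarith)
    (hMh _ (by linarith)) (c := α * (c * q) / n * (1 - Real.exp (-n * δ)))
    (mul_nonneg (by positivity) (by linarith)) hj hpull hhW (by linarith)
  refine ⟨t + W, by linarith, j, hj, hjS, fun k hk => ?_⟩
  rcases Finset.mem_insert.1 hk with rfl | hk
  · calc min q γ * c ≤ γ * c := mul_le_mul_of_nonneg_right (min_le_right _ _) hc
      _ = α * (c * q) / n * (1 - Real.exp (-n * δ)) * Real.exp (-n * W) := by rw [hγ]; ring
      _ ≤ _ := hj'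
  · calc min q γ * c ≤ q * c := mul_le_mul_of_nonneg_right (min_le_left _ _) hc
      _ = c * q := mul_comm _ _
      _ ≤ _ := hgap' _ ⟨by linarith, le_rfl⟩ k hk

/-- The spread of the agents in `C` is eventually multiplied by a uniform factor less than `1`. -/
theorem exists_contraction (hE : HasReciprocalEvents a E C α δ W T₀) (hy : IsConsensusFlow a y)
    (hC : C.Nonempty) :
    ∃ ρ : ℝ, 0 ≤ ρ ∧ ρ < 1 ∧ ∀ s B : ℝ, T₀ ≤ s → (∀ i ∈ C, ∀ j ∈ C, y i s - y j s ≤ B) →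
      ∃ s', s ≤ s' ∧ ∀ i ∈ C, ∀ j ∈ C, y i s' - y j s' ≤ ρ * B := by
  classical
  obtain ⟨i₀, hi₀⟩ := hC
  have : Nonempty ι := ⟨i₀⟩
  obtain ⟨κ, hκ, hgrow⟩ := hE.exists_growth hy
  -- Induction on the number `m` of agents of `C` still outside `S`, each costing one factor `κ`.
  have main : ∀ (m : ℕ) (s M c : ℝ) (S : Finset ι), T₀ ≤ s → S ⊆ C → S.Nonempty →
      (C \ S).card = m → (∀ i ∈ C, y i s ≤ M) → 0 ≤ c → (∀ i ∈ S, c ≤ M - y i s) →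
      ∃ s', s ≤ s' ∧ ∀ i ∈ C, κ ^ m * c ≤ M - y i s' := by
    intro m
    induction m with
    | zero =>
      intro s M c S hs hS hSn hcard hM hc hcS
      refine ⟨s, le_rfl, fun i hi => ?_⟩
      rw [pow_zero, one_mul]
      exact hcS i (Finset.sdiff_eq_empty_iff_subset.1 (Finset.card_eq_zero.1 hcard) hi)
    | succ m ih =>
      intro s M c S hs hS hSn hcard hM hc hcS
      have hSC : S ⊂ C := by
        refine hS.ssubset_of_ne ?_
        rintro rfl
        simp at hcard
      obtain ⟨s₁, hs₁, j, hj, hjS, hgap⟩ := hgrow s M c S hs hSC hSn hM hc hcS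
      have hcard' : (C \ insert j S).card = m := by
        rw [Finset.sdiff_insert, Finset.card_erase_of_mem (Finset.mem_sdiff.2 ⟨hj, hjS⟩), hcard]
        rfl
      obtain ⟨s₂, hs₂, h₂⟩ := ih s₁ M (κ * c) (insert j S) (hs.trans hs₁)
        (Finset.insert_subset hj hS) (Finset.insert_nonempty _ _) hcard'
        (hE.upper_bound_persists hy hs hM hs₁) (mul_nonneg hκ.le hc) hgap
      refine ⟨s₂, hs₁.trans hs₂, fun i hi => ?_⟩
      rw [pow_succ, mul_assoc]
      exact h₂ i hi
  -- The growth starts from a single minimal agent, whose margin is the whole spread. The minimum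
  -- with `1` keeps `1 - θ` nonnegative.
  set θ : ℝ := min (κ ^ (C.card - 1)) 1 with hl
  have hl0 : 0 < θ := lt_min (pow_pos hκ _) one_pos
  have hl1 : θ ≤ 1 := min_le_right _ _
  refine ⟨1 - θ, by linarith, by linarith, fun s B hs hB => ?_⟩
  obtain ⟨p, hp, hpmax⟩ := C.exists_max_image (fun i => y i s) ⟨i₀, hi₀⟩
  obtain ⟨r, hr, hrmin⟩ := C.exists_min_image (fun i => y i s) ⟨i₀, hi₀⟩
  have hc : 0 ≤ y p s - y r s := sub_nonneg.2 (hpmax r hr)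
  obtain ⟨s', hs', hup⟩ := main (C.card - 1) s (y p s) (y p s - y r s) {r} hs
    (Finset.singleton_subset_iff.2 hr) (Finset.singleton_nonempty r)
    (by rw [Finset.card_sdiff_of_subset (Finset.singleton_subset_iff.2 hr),
      Finset.card_singleton]) hpmax hc (by simp)
  refine ⟨s', hs', fun i hi j hj => ?_⟩
  have h1 := hup i hi
  have h2 := hE.lower_bound_persists hy hs hrmin hs' j hj
  have h3 : θ * (y p s - y r s) ≤ κ ^ (C.card - 1) * (y p s - y r s) :=
    mul_le_mul_of_nonneg_right (min_le_left _ _) hc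
  have h4 := hB p hp r hr
  nlinarith

/-- Consensus among the agents in `C`. -/
theorem eventually_sub_le (hE : HasReciprocalEvents a E C α δ W T₀) (hy : IsConsensusFlow a y)
    {ε : ℝ} (hε : 0 < ε) : ∀ᶠ t in atTop, ∀ i ∈ C, ∀ j ∈ C, y i t - y j t ≤ ε := by
  rcases C.eq_empty_or_nonempty with rfl | hC
  · simp
  obtain ⟨ρ, hρ0, hρ1, hcontr⟩ := hE.exists_contraction hy hC
  obtain ⟨p, hp, hpmax⟩ := C.exists_max_image (fun i => y i T₀) hC
  obtain ⟨r, hr, hrmin⟩ := C.exists_min_image (fun i => y i T₀) hC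
  have hk : ∀ k : ℕ, ∃ s, T₀ ≤ s ∧
      ∀ i ∈ C, ∀ j ∈ C, y i s - y j s ≤ ρ ^ k * (y p T₀ - y r T₀) := by
    intro k
    induction k with
    | zero =>
      refine ⟨T₀, le_rfl, fun i hi j hj => ?_⟩
      rw [pow_zero, one_mul]
      exact sub_le_sub (hpmax i hi) (hrmin j hj)
    | succ k ih =>
      obtain ⟨s, hs, h⟩ := ih
      obtain ⟨s', hs', h'⟩ := hcontr s _ hs h
      refine ⟨s', hs.trans hs', fun i hi j hj => ?_⟩
      rw [pow_succ', mul_assoc]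
      exact h' i hi j hj
  have hlim : Tendsto (fun k : ℕ => ρ ^ k * (y p T₀ - y r T₀)) atTop (𝓝 0) := by
    simpa using (tendsto_pow_atTop_nhds_zero_of_lt_one hρ0 hρ1).mul_const (y p T₀ - y r T₀)
  obtain ⟨k, hkε⟩ := (hlim.eventually (gt_mem_nhds hε)).exists
  obtain ⟨s, hs, h⟩ := hk k
  filter_upwards [eventually_ge_atTop s] with t ht i hi j hj
  obtain ⟨p', hp', hpmax'⟩ := C.exists_max_image (fun i => y i s) hC
  obtain ⟨r', hr', hrmin'⟩ := C.exists_min_image (fun i => y i s) hC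
  have h1 := hE.upper_bound_persists hy hs hpmax' ht i hi
  have h2 := hE.lower_bound_persists hy hs hrmin' ht j hj
  linarith [h p' hp' r' hr']

end HasReciprocalEvents

end MobileRobots

/-! ### Components of a symmetric relation -/

/-- The connected component of a point for a symmetric relation, characterized by the absence of
smaller closed parts. -/
theorem exists_minimal_closed_finset {ι : Type*} [Fintype ι] {R : ι → ι → Prop}
    (hR : ∀ i j, R i j → R j i) (i₀ : ι) :
    ∃ C : Finset ι, i₀ ∈ C ∧ (∀ i ∈ C, ∀ j ∉ C, ¬ R i j) ∧
      ∀ S ⊂ C, S.Nonempty → ∃ i ∈ S, ∃ j ∈ C, j ∉ S ∧ R i j := by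
  classical
  obtain ⟨C, hC, hmin⟩ := (Finset.univ.filter
    (fun C : Finset ι => i₀ ∈ C ∧ ∀ i ∈ C, ∀ j ∉ C, ¬ R i j)).exists_min_image Finset.card
    ⟨Finset.univ, by simp⟩
  simp only [Finset.mem_filter, Finset.mem_univ, true_and] at hC hmin
  refine ⟨C, hC.1, hC.2, fun S hS hSn => ?_⟩
  by_contra! hno
  -- Without an edge from `S` to `C \ S`, whichever of the two contains `i₀` is a smaller closed
  -- set.
  by_cases h0 : i₀ ∈ S
  · refine absurd (hmin S ⟨h0, fun i hi j hj => ?_⟩) (not_le.2 (Finset.card_lt_card hS))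
    by_cases hjC : j ∈ C
    · exact hno i hi j hjC hj
    · exact hC.2 i (hS.1 hi) j hjC
  · refine absurd (hmin (C \ S) ⟨Finset.mem_sdiff.2 ⟨hC.1, h0⟩, fun i hi j hj => ?_⟩)
      (not_le.2 (Finset.card_lt_card (Finset.sdiff_ssubset hS.1 hSn)))
    rw [Finset.mem_sdiff] at hi hj
    by_cases hjC : j ∈ C
    · have hjS : j ∈ S := by by_contra h; exact hj ⟨hjC, h⟩
      exact fun h => hno j hjS i hi.1 hi.2 (hR _ _ h)
    · exact hC.2 i hi.1 j hjC

/-! ### Saturation and wake-up schedules -/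

namespace MobileRobots

/-- The factor by which `sat μ` rescales a vector. -/
noncomputable def satFactor (μ : ℝ) (v : Plane) : ℝ := if μ ≤ ‖v‖ then μ / ‖v‖ else 1

theorem sat_eq_smul (μ : ℝ) (v : Plane) : sat μ v = satFactor μ v • v := by
  unfold sat satFactor
  split_ifs <;> simp

theorem satFactor_nonneg {μ : ℝ} (hμ : 0 < μ) (v : Plane) : 0 ≤ satFactor μ v := by
  unfold satFactor
  split_ifs <;> positivity

theorem satFactor_le_one {μ : ℝ} (hμ : 0 < μ) (v : Plane) : satFactor μ v ≤ 1 := by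
  unfold satFactor
  split_ifs with h
  · exact (div_le_one (hμ.trans_le h)).2 h
  · exact le_rfl

theorem le_satFactor {μ r : ℝ} (hμ : 0 < μ) {v : Plane} (hv : ‖v‖ ≤ r) :
    min 1 (μ / r) ≤ satFactor μ v := by
  unfold satFactor
  split_ifs with h
  · exact (min_le_right _ _).trans (div_le_div_of_nonneg_left hμ.le (hμ.trans_le h) hv)
  · exact min_le_left _ _

theorem norm_sat_le {μ : ℝ} (hμ : 0 < μ) (v : Plane) : ‖sat μ v‖ ≤ μ := by
  unfold sat
  split_ifs with h
  · have hv : 0 < ‖v‖ := hμ.trans_le h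
    rw [norm_smul, Real.norm_of_nonneg (by positivity), div_mul_cancel₀ _ hv.ne']
  · exact (not_le.1 h).le

theorem norm_plane_le (v : Plane) : ‖v‖ ≤ |v 0| + |v 1| := by
  rw [EuclideanSpace.norm_eq, Fin.sum_univ_two]
  refine Real.sqrt_le_iff.2 ⟨by positivity, ?_⟩
  simp only [Real.norm_eq_abs]
  nlinarith [mul_nonneg (abs_nonneg (v 0)) (abs_nonneg (v 1))]

section Schedule

variable {n : ℕ} {δmin δmax : ℝ} {τ : Fin n → ℕ → ℝ}

theorem IsWakeUpSchedule.mul_le (hτ : IsWakeUpSchedule δmin δmax τ) (i : Fin n) (k : ℕ) :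
    k * δmin ≤ τ i k := by
  induction k with
  | zero => simpa using hτ.zero_le i
  | succ k ih =>
    have := (hτ.gap_mem i k).1
    push_cast
    linarith

theorem IsWakeUpSchedule.nonneg (hτ : IsWakeUpSchedule δmin δmax τ) (hδmin : 0 < δmin)
    (i : Fin n) (k : ℕ) : 0 ≤ τ i k :=
  le_trans (by positivity) (hτ.mul_le i k)

theorem IsWakeUpSchedule.exists_ge (hτ : IsWakeUpSchedule δmin δmax τ) (hδmin : 0 < δmin)
    (i : Fin n) (s : ℝ) : ∃ k, s ≤ τ i k := by
  obtain ⟨k, hk⟩ := exists_nat_ge (s / δmin)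
  exact ⟨k, ((div_le_iff₀ hδmin).1 hk).trans (hτ.mul_le i k)⟩

/-- Every robot wakes up in every time window of length `δmax`. -/
theorem IsWakeUpSchedule.exists_mem_Icc (hτ : IsWakeUpSchedule δmin δmax τ) (hδmin : 0 < δmin)
    (i : Fin n) {s : ℝ} (hs : 0 ≤ s) : ∃ k, τ i k ∈ Set.Icc s (s + δmax) := by
  classical
  have hex := hτ.exists_ge hδmin i s
  refine ⟨Nat.find hex, Nat.find_spec hex, ?_⟩
  rcases Nat.eq_zero_or_pos (Nat.find hex) with h0 | h0
  · rw [h0]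
    linarith [hτ.first_le i]
  · obtain ⟨m, hm⟩ := Nat.exists_eq_succ_of_ne_zero h0.ne'
    have hlt := not_le.1 (Nat.find_min hex (m := m) (by omega))
    rw [hm]
    linarith [(hτ.gap_mem i m).2]

end Schedule

/-- One of the robots `i` and `j` wakes up at time `s` and finds the other one at distance at
least `d₁`. -/
def IsEngagement {n : ℕ} (d₁ : ℝ) (τ : Fin n → ℕ → ℝ) (x : Fin n → ℝ → Plane)
    (i j : Fin n) (s : ℝ) : Prop :=
  ((∃ k, τ i k = s) ∨ ∃ k, τ j k = s) ∧ d₁ ≤ ‖x i s - x j s‖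

theorem IsEngagement.symm {n : ℕ} {d₁ : ℝ} {τ : Fin n → ℕ → ℝ} {x : Fin n → ℝ → Plane}
    {i j : Fin n} {s : ℝ} (h : IsEngagement d₁ τ x i j s) : IsEngagement d₁ τ x j i s :=
  ⟨h.1.symm, by rw [norm_sub_rev]; exact h.2⟩

/-- The weights of the consensus dynamics after the saturation has been absorbed. -/
noncomputable def satWeight {n : ℕ} (μ d₀ d₁ δmin δmax : ℝ) (τ : Fin n → ℕ → ℝ)
    (x : Fin n → ℝ → Plane) (i j : Fin n) (t : ℝ) : ℝ :=
  satFactor μ (∑ k, weight d₀ d₁ δmin δmax τ x i k t • (x k t - x i t)) *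
    weight d₀ d₁ δmin δmax τ x i j t

/-! ### Trajectories of the robots -/

section Trajectory

variable {n : ℕ} {μ d₀ d₁ δmin δmax : ℝ} {τ : Fin n → ℕ → ℝ} {x : Fin n → ℝ → Plane}

theorem weight_nonneg (i j : Fin n) (t : ℝ) : 0 ≤ weight d₀ d₁ δmin δmax τ x i j t := by
  unfold weight
  split_ifs <;> norm_num

theorem weight_le_one (i j : Fin n) (t : ℝ) : weight d₀ d₁ δmin δmax τ x i j t ≤ 1 := by
  unfold weight
  split_ifs <;> norm_num

/-- The saturation factor is a scalar common to both coordinates, so it can be absorbed into the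
weights and the coordinates treated separately. -/
theorem velocity_apply (i : Fin n) (t : ℝ) (k : Fin 2) :
    velocity μ d₀ d₁ δmin δmax τ x i t k =
      ∑ j, satWeight μ d₀ d₁ δmin δmax τ x i j t * (x j t k - x i t k) := by
  unfold velocity satWeight
  rw [sat_eq_smul, PiLp.smul_apply, WithLp.ofLp_sum, Finset.sum_apply, smul_eq_mul,
    Finset.mul_sum]
  refine Finset.sum_congr rfl fun j _ => ?_
  rw [PiLp.smul_apply, PiLp.sub_apply, smul_eq_mul, mul_assoc]

theorem IsTrajectory.integrable (hx : IsTrajectory μ d₀ d₁ δmin δmax τ x) (i : Fin n) {s t : ℝ}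
    (hs : 0 ≤ s) (hst : s ≤ t) :
    IntervalIntegrable (velocity μ d₀ d₁ δmin δmax τ x i) volume s t :=
  (hx i s hs).1.symm.trans (hx i t (hs.trans hst)).1

theorem IsTrajectory.sub_eq (hx : IsTrajectory μ d₀ d₁ δmin δmax τ x) (i : Fin n) {s t : ℝ}
    (hs : 0 ≤ s) (hst : s ≤ t) :
    x i t - x i s = ∫ u in s..t, velocity μ d₀ d₁ δmin δmax τ x i u := by
  rw [(hx i t (hs.trans hst)).2, (hx i s hs).2, add_sub_add_left_eq_sub,
    intervalIntegral.integral_interval_sub_left (hx i t (hs.trans hst)).1 (hx i s hs).1]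

theorem IsTrajectory.norm_sub_le (hx : IsTrajectory μ d₀ d₁ δmin δmax τ x) (hμ : 0 < μ)
    (i : Fin n) {s t : ℝ} (hs : 0 ≤ s) (hst : s ≤ t) : ‖x i t - x i s‖ ≤ μ * (t - s) := by
  rw [hx.sub_eq i hs hst, ← abs_of_nonneg (sub_nonneg.2 hst)]
  exact intervalIntegral.norm_integral_le_of_norm_le_const fun u _ => norm_sat_le hμ _

theorem IsTrajectory.continuousOn (hx : IsTrajectory μ d₀ d₁ δmin δmax τ x) (hμ : 0 < μ)
    (i : Fin n) : ContinuousOn (x i) (Set.Ici 0) := by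
  refine LipschitzOnWith.continuousOn (K := μ.toNNReal) (LipschitzOnWith.of_dist_le_mul ?_)
  intro s hs t ht
  rw [dist_eq_norm, Real.dist_eq, Real.coe_toNNReal μ hμ.le]
  rcases le_total s t with h | h
  · rw [norm_sub_rev, abs_sub_comm, abs_of_nonneg (sub_nonneg.2 h)]
    exact hx.norm_sub_le hμ i hs h
  · rw [abs_of_nonneg (sub_nonneg.2 h)]
    exact hx.norm_sub_le hμ i ht h

/-- Each coordinate of a trajectory follows linear consensus dynamics. -/
theorem IsTrajectory.isConsensusFlow (hx : IsTrajectory μ d₀ d₁ δmin δmax τ x) (hμ : 0 < μ)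
    (k : Fin 2) :
    IsConsensusFlow (satWeight μ d₀ d₁ δmin δmax τ x) (fun i t => x i t k) := by
  have e : ∀ i, (fun u => ∑ j, satWeight μ d₀ d₁ δmin δmax τ x i j u * (x j u k - x i u k)) =
      fun u => (EuclideanSpace.proj k : Plane →L[ℝ] ℝ)
        (velocity μ d₀ d₁ δmin δmax τ x i u) := by
    intro i; funext u; exact (velocity_apply i u k).symm
  refine ⟨fun i j t => mul_nonneg (satFactor_nonneg hμ _) (weight_nonneg i j t),
    fun i j t => mul_le_one₀ (satFactor_le_one hμ _) (weight_nonneg i j t) (weight_le_one i j t),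
    fun i => ?_, fun i s t hs hst => ?_, fun i s t hs hst => ?_⟩
  · exact (EuclideanSpace.proj k : Plane →L[ℝ] ℝ).continuous.comp_continuousOn
      (hx.continuousOn hμ i)
  · rw [e]
    have h := hx.integrable i hs hst
    exact ⟨ContinuousLinearMap.integrable_comp _ h.1, ContinuousLinearMap.integrable_comp _ h.2⟩
  · rw [e, ContinuousLinearMap.intervalIntegral_comp_comm _ (hx.integrable i hs hst),
      ← hx.sub_eq i hs hst]
    rfl

/-- The maximum principle for the set of all robots, which is trivially closed, confines each
coordinate to its initial range. -/
theorem IsTrajectory.exists_bound (hx : IsTrajectory μ d₀ d₁ δmin δmax τ x) (hμ : 0 < μ) :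
    ∃ r : ℝ, 0 ≤ r ∧ ∀ i t, 0 ≤ t → ‖x i t‖ ≤ r := by
  set r : ℝ := ∑ i, ‖x i 0‖ with hr
  have hr0 : 0 ≤ r := Finset.sum_nonneg fun i _ => norm_nonneg _
  refine ⟨r + r, by linarith, fun i t ht => (norm_plane_le _).trans ?_⟩
  have h0 : ∀ i k, |x i 0 k| ≤ r := fun i k =>
    (PiLp.norm_apply_le (x i 0) k).trans
      (Finset.single_le_sum (f := fun i => ‖x i 0‖) (fun i _ => norm_nonneg _)
        (Finset.mem_univ i))
  have h1 : ∀ k, |x i t k| ≤ r := fun k => abs_le.2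
    ⟨(hx.isConsensusFlow hμ k).ge_of_closed (b := t) le_rfl (S := Finset.univ) (by simp)
      (fun i _ => (abs_le.1 (h0 i k)).1) t ⟨ht, le_rfl⟩ i (Finset.mem_univ i),
    (hx.isConsensusFlow hμ k).le_of_closed (b := t) le_rfl (S := Finset.univ) (by simp)
      (fun i _ => (abs_le.1 (h0 i k)).2) t ⟨ht, le_rfl⟩ i (Finset.mem_univ i)⟩
  exact add_le_add (h1 0) (h1 1)

/-- The saturation factors are bounded away from zero. -/
theorem IsTrajectory.exists_le_satWeight (hx : IsTrajectory μ d₀ d₁ δmin δmax τ x) (hμ : 0 < μ) :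
    ∃ α : ℝ, 0 < α ∧ ∀ i j t, 0 ≤ t → weight d₀ d₁ δmin δmax τ x i j t = 1 →
      α ≤ satWeight μ d₀ d₁ δmin δmax τ x i j t := by
  obtain ⟨r, hr0, hr⟩ := hx.exists_bound hμ
  have hpos : 0 < n * (r + r) + 1 := by positivity
  refine ⟨min 1 (μ / (n * (r + r) + 1)), lt_min one_pos (div_pos hμ hpos),
    fun i j t ht hw => ?_⟩
  rw [satWeight, hw, mul_one]
  refine le_satFactor hμ ?_
  calc _ ≤ ∑ k : Fin n, ‖weight d₀ d₁ δmin δmax τ x i k t • (x k t - x i t)‖ := norm_sum_le _ _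
    _ ≤ ∑ _k : Fin n, (r + r) := by
        refine Finset.sum_le_sum fun k _ => ?_
        rw [norm_smul, Real.norm_of_nonneg (weight_nonneg i k t)]
        calc _ ≤ 1 * ‖x k t - x i t‖ :=
              mul_le_mul_of_nonneg_right (weight_le_one i k t) (norm_nonneg _)
          _ ≤ r + r := by
              rw [one_mul]
              exact (_root_.norm_sub_le _ _).trans (add_le_add (hr k t ht) (hr i t ht))
    _ = n * (r + r) := by
        rw [Finset.sum_const, Finset.card_univ, Fintype.card_fin, nsmul_eq_mul]
    _ ≤ n * (r + r) + 1 := by linarith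

/-- A robot is only attracted by another one if an engagement took place recently. -/
theorem exists_engagement_of_weight_ne_zero (hδ : δmin < δmax) (hδmin : 0 < δmin)
    {i j : Fin n} {t : ℝ} (h : weight d₀ d₁ δmin δmax τ x i j t ≠ 0) :
    ∃ s ∈ Set.Icc (t - 2 * δmax) t, IsEngagement d₁ τ x i j s := by
  have h' : Engages d₁ δmin τ x i j t ∨ Reciprocates d₀ d₁ δmin δmax τ x i j t := by
    by_contra hno
    exact h (if_neg hno)
  rcases h' with ⟨k, hk, hd⟩ | ⟨l, hl, -, k, hk, hd⟩
  · exact ⟨τ i k, ⟨by linarith [hk.2], hk.1⟩, Or.inl ⟨k, rfl⟩, hd⟩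
  · exact ⟨τ j k, ⟨by linarith [hl.2, hk.1], hk.2.trans hl.1⟩, Or.inr ⟨k, rfl⟩, hd⟩

/-- After an engagement, each of the two robots is attracted by the other one for a duration
`δmin`. -/
theorem IsTrajectory.exists_weight_eq_one (hx : IsTrajectory μ d₀ d₁ δmin δmax τ x) (hμ : 0 < μ)
    (hδmin : 0 < δmin) (hδ : δmin < δmax) (hspeed : 4 * δmax * μ ≤ d₁ - d₀)
    (hτ : IsWakeUpSchedule δmin δmax τ) {i j : Fin n} {s : ℝ} (h : IsEngagement d₁ τ x i j s) :
    ∃ b, s ≤ b ∧ b + δmin ≤ s + 2 * δmax ∧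
      ∀ t ∈ Set.Icc b (b + δmin), weight d₀ d₁ δmin δmax τ x i j t = 1 := by
  obtain ⟨⟨k, rfl⟩ | ⟨k, rfl⟩, hd⟩ := h
  · exact ⟨τ i k, le_rfl, by linarith, fun t ht => if_pos (Or.inl ⟨k, ht, hd⟩)⟩
  · have hs := hτ.nonneg hδmin j k
    -- Robot `i` wakes within `δmax` and monitors for `δmin`, so at most `2 * δmax` elapses. Each
    -- robot moves at most `2 * δmax * μ`, and the distance stays at least `d₁ - 4 * δmax * μ ≥ d₀`.
    obtain ⟨m, hm⟩ := hτ.exists_mem_Icc hδmin i hs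
    refine ⟨τ i m, hm.1, by linarith [hm.2], fun t ht =>
      if_pos (Or.inr ⟨m, ht, ?_, k, ⟨by linarith [hm.2], hm.1⟩, hd⟩)⟩
    have hst : τ j k ≤ t := hm.1.trans ht.1
    have h1 := hx.norm_sub_le hμ i hs hst
    have h2 := hx.norm_sub_le hμ j hs hst
    have h3 : x i (τ j k) - x j (τ j k) =
        (x i t - x j t) - (x i t - x i (τ j k)) + (x j t - x j (τ j k)) := by abel
    have h4 : ‖x i (τ j k) - x j (τ j k)‖ ≤
        ‖x i t - x j t‖ + ‖x i t - x i (τ j k)‖ + ‖x j t - x j (τ j k)‖ := by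
      rw [h3]
      exact (norm_add_le _ _).trans (add_le_add_left (_root_.norm_sub_le _ _) _)
    have h5 : μ * (t - τ j k) ≤ μ * (2 * δmax) :=
      mul_le_mul_of_nonneg_left (by linarith [ht.2, hm.2]) hμ.le
    linarith

/-- Any two robots are engaged only finitely often. -/
theorem IsTrajectory.eventually_not_isEngagement (hx : IsTrajectory μ d₀ d₁ δmin δmax τ x)
    (hμ : 0 < μ) (hd₁ : 0 < d₁) (hδmin : 0 < δmin) (hδ : δmin < δmax)
    (hspeed : 4 * δmax * μ ≤ d₁ - d₀) (hτ : IsWakeUpSchedule δmin δmax τ) (i j : Fin n) :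
    ∀ᶠ s in atTop, ¬ IsEngagement d₁ τ x i j s := by
  by_contra hij
  obtain ⟨C, hiC, hcl, hconn⟩ := exists_minimal_closed_finset
    (R := fun i j => ∃ᶠ s in atTop, IsEngagement d₁ τ x i j s)
    (fun i j h => h.mono fun s hs => hs.symm) i
  have hjC : j ∈ C := by
    by_contra hjC
    exact hcl i hiC j hjC hij
  have hev : ∀ᶠ s in atTop, ∀ i ∈ C, ∀ j ∉ C, ¬ IsEngagement d₁ τ x i j s := by
    refine (Finset.eventually_all C).2 fun i hi => eventually_all.2 fun j => ?_
    by_cases hj : j ∈ C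
    · simp [hj]
    · exact (not_frequently.1 (hcl i hi j hj)).mono fun s hs _ => hs
  obtain ⟨T, hT⟩ := eventually_atTop.1 hev
  obtain ⟨α, hα, hαw⟩ := hx.exists_le_satWeight hμ
  -- The start is delayed by `2 * δmax` so that the engagements behind active weights occur after
  -- `T`.
  have hE : HasReciprocalEvents (satWeight μ d₀ d₁ δmin δmax τ x) (IsEngagement d₁ τ x) C
      α δmin (2 * δmax) (max T 0 + 2 * δmax) := by
    have hT0 : T ≤ max T 0 := le_max_left _ _
    have h0 : 0 ≤ max T 0 := le_max_right _ _
    have hact : ∀ i j t, satWeight μ d₀ d₁ δmin δmax τ x i j t ≠ 0 →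
        ∃ s ∈ Set.Icc (t - 2 * δmax) t, IsEngagement d₁ τ x i j s := fun i j t h =>
      exists_engagement_of_weight_ne_zero hδ hδmin (right_ne_zero_of_mul h)
    refine ⟨hα, hδmin, by linarith, by linarith, fun i j s h => h.symm,
      fun i j t _ h => hact i j t h, fun i j s hs h => ?_, fun i hi j hj t ht => ?_,
      fun S hS hSn T' => ?_⟩
    · obtain ⟨b, hsb, hb, hw⟩ := hx.exists_weight_eq_one hμ hδmin hδ hspeed hτ h
      exact ⟨b, hsb, hb, fun t ht => hαw i j t (by linarith [ht.1]) (hw t ht)⟩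
    · by_contra hne
      obtain ⟨s, hs, h⟩ := hact i j t hne
      exact hT s (by linarith [hs.1]) i hi j hj h
    · obtain ⟨i, hi, j, hj, hjS, hR⟩ := hconn S hS hSn
      obtain ⟨s, hs, h⟩ := (frequently_atTop.1 hR) T'
      exact ⟨s, hs, i, hi, j, hj, hjS, h⟩
  -- Two coordinates within `d₁ / 4` give a distance at most `d₁ / 2 < d₁`.
  have hc := fun k => hE.eventually_sub_le (hx.isConsensusFlow hμ k) (ε := d₁ / 4) (by linarith)
  obtain ⟨s, hs, h0, h1⟩ := (Frequently.and_eventually hij ((hc 0).and (hc 1))).exists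
  have habs : ∀ k : Fin 2, (∀ i ∈ C, ∀ j ∈ C, x i s k - x j s k ≤ d₁ / 4) →
      |(x i s - x j s) k| ≤ d₁ / 4 := fun k h => by
    rw [PiLp.sub_apply]
    exact abs_le.2 ⟨by linarith [h j hjC i hiC], h i hiC j hjC⟩
  have := norm_plane_le (x i s - x j s)
  linarith [habs 0 h0, habs 1 h1, hs.2]

/-- All robots stop after finite time. -/
theorem IsTrajectory.exists_forall_eq (hx : IsTrajectory μ d₀ d₁ δmin δmax τ x)
    (hμ : 0 < μ) (hd₁ : 0 < d₁) (hδmin : 0 < δmin) (hδ : δmin < δmax)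
    (hspeed : 4 * δmax * μ ≤ d₁ - d₀) (hτ : IsWakeUpSchedule δmin δmax τ) :
    ∃ T, (∀ i t, T ≤ t → x i t = x i T) ∧ ∀ i j t, T ≤ t → ¬ IsEngagement d₁ τ x i j t := by
  have hev : ∀ᶠ s in atTop, ∀ i j, ¬ IsEngagement d₁ τ x i j s :=
    eventually_all.2 fun i => eventually_all.2 fun j =>
      hx.eventually_not_isEngagement hμ hd₁ hδmin hδ hspeed hτ i j
  obtain ⟨T, hT⟩ := eventually_atTop.1 hev
  have hT0 : T ≤ max T 0 := le_max_left _ _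
  have h0 : 0 ≤ max T 0 := le_max_right _ _
  refine ⟨max T 0 + 2 * δmax, fun i t ht => ?_, fun i j t ht => hT t (by linarith) i j⟩
  rw [← sub_eq_zero, hx.sub_eq i (by linarith) ht]
  refine intervalIntegral.integral_zero_ae (Eventually.of_forall fun u hu => ?_)
  rw [Set.uIoc_of_le ht] at hu
  have hw : ∀ j, weight d₀ d₁ δmin δmax τ x i j u = 0 := fun j => by
    by_contra hne
    obtain ⟨s, hs, h⟩ := exists_engagement_of_weight_ne_zero hδ hδmin hne
    exact hT s (by linarith [hs.1, hu.1]) i j h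
  simp [velocity, hw, sat_eq_smul]

end Trajectory

end MobileRobots

theorem proposition2 (n : ℕ) [NeZero n] (μ d₀ d₁ δmin δmax : ℝ)
    (hμ : 0 < μ) (hd₀ : 0 < d₀) (hd : d₀ < d₁) (hδmin : 0 < δmin) (hδ : δmin < δmax)
    (hspeed : 4 * δmax * μ ≤ d₁ - d₀)
    (τ : Fin n → ℕ → ℝ) (hτ : MobileRobots.IsWakeUpSchedule δmin δmax τ)
    (x : Fin n → ℝ → MobileRobots.Plane)
    (hx : MobileRobots.IsTrajectory μ d₀ d₁ δmin δmax τ x) :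
    (∀ i, ∃ p : MobileRobots.Plane, Tendsto (x i) atTop (𝓝 p)) ∧
      ∃ L : ℝ, Tendsto (MobileRobots.groupDiam x) atTop (𝓝 L) ∧ L ≤ d₁ := by
  obtain ⟨T, hT, hno⟩ := hx.exists_forall_eq hμ (hd₀.trans hd) hδmin hδ hspeed hτ
  refine ⟨fun i => ⟨x i T, ?_⟩, MobileRobots.groupDiam x T, ?_, ?_⟩
  · refine tendsto_const_nhds.congr' ?_
    filter_upwards [eventually_ge_atTop T] with t ht using (hT i t ht).symm
  · refine tendsto_const_nhds.congr' ?_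
    filter_upwards [eventually_ge_atTop T] with t ht
    unfold MobileRobots.groupDiam
    simp only [hT _ t ht]
  · refine Finset.sup'_le _ _ fun p _ => ?_
    -- Positions being frozen, a wake-up after `T` measures the final distance.
    obtain ⟨k, hk⟩ := hτ.exists_ge hδmin p.1 T
    rw [← hT p.1 _ hk, ← hT p.2 _ hk]
    by_contra! hlt
    exact hno p.1 p.2 _ hk ⟨Or.inl ⟨k, rfl⟩, hlt.le⟩
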